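/- For $n\ge 1$ let $\mathbb B^{n+1}$ be the open unit ball of $\mathbb R^{n+1}$, with boundary $\mathbb S^n$ and outward unit normal derivative $\eta$ on $\mathbb S^n$. For $z_0\in\mathbb B^{n+1}$ put $\omega_0=\frac{z_0}{|z_0|^2}\bigl(1-\sqrt{1-|z_0|^2}\bigr)$ (with $\omega_0=0$ if $z_0=0$); then $\omega_0\in\mathbb B^{n+1}$. For $\xi,\omega\in\overline{\mathbb B^{n+1}}$ let $F(\xi,\omega)=\left|\frac{\xi}{|\xi|}-|\xi|\omega\right|$ if $\xi\ne0$, and $F(0,\omega)=1$ (the continuous extension). Solutions below are classical: $v\in C^4(\mathbb B^{n+1})\cap C^1(\overline{\mathbb B^{n+1}})$. (1) Let $n=3$ and $z_0\in\mathbb B^4$. The problem $$\Delta^2v=0\ \text{ in }\mathbb B^4,\qquad \eta v=0\ \text{ on }\mathbb S^3,\qquad v(\xi)=-\log|1-\langle z_0,\xi\rangle|\ \text{ on }\mathbb S^3$$ has exactly one solution, namely, for $\xi\in\overline{\mathbb B^4}$, $$v(\xi)=-\log F(\xi,\omega_0)^2+\frac{1-|\xi|^2}{2}\left[\frac{1-|\omega_0|^2}{F(\xi,\omega_0)^2}-1\right]+\log(1+|\omega_0|^2).$$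 (2) Let $n>3$ be an integer and $z_0\in\mathbb B^{n+1}$. The problem $$\Delta^2v=0\ \text{ in }\mathbb B^{n+1},\qquad \eta v=-\frac{n-3}{2}\,v\ \text{ on }\mathbb S^n,\qquad v(\xi)=|1-\langle z_0,\xi\rangle|^{\frac{3-n}{2}}\ \text{ on }\mathbb S^n$$ has exactly one solution, namely, for $\xi\in\overline{\mathbb B^{n+1}}$, $$v(\xi)=\frac{(1+|\omega_0|^2)^{\frac{n-3}{2}}}{F(\xi,\omega_0)^{n-3}}\left[1+\frac{(n-3)(1-|\omega_0|^2)(1-|\xi|^2)}{4F(\xi,\omega_0)^2}\right].$$ -/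

import Mathlib

open Metric

noncomputable section

/-- The space `ℝ^(n+1)` with its Euclidean norm; its open unit ball `ball 0 1` is `𝔹^(n+1)` and
its unit sphere `sphere 0 1` is `𝕊^n`. -/
abbrev Euc (n : ℕ) : Type := EuclideanSpace ℝ (Fin (n + 1))

/-- `ω₀ = z₀ / |z₀|² (1 - √(1 - |z₀|²))`; for `z₀ = 0` this gives `0`, the limit as `z₀ → 0`. -/
def omegaZero {n : ℕ} (z₀ : Euc n) : Euc n :=
  ((1 - √(1 - ‖z₀‖ ^ 2)) / ‖z₀‖ ^ 2) • z₀

open Classical in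
/-- `F(ξ, ω) = | ξ/|ξ| - |ξ| ω |` for `ξ ≠ 0`, extended continuously by `F(0, ω) = 1`. -/
def F {n : ℕ} (ξ ω : Euc n) : ℝ :=
  if ξ = 0 then 1 else ‖(‖ξ‖⁻¹ • ξ) - ‖ξ‖ • ω‖

/-- The outward normal derivative `η v` at a point `ξ` of the unit sphere (where the outward unit
normal is `ξ` itself), for a function that is differentiable up to the boundary of the unit ball:
the differential is taken within the closed ball, so values of `v` outside it play no role. -/
def normalDeriv {n : ℕ} (v : Euc n → ℝ) (ξ : Euc n) : ℝ :=
  fderivWithin ℝ v (closedBall 0 1) ξ ξ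

/-- `v` is a classical solution of `Δ² v = 0` in the unit ball, `η v = g` and `v = f` on the unit
sphere: it is `C⁴` in the open ball and `C¹` up to the boundary. -/
structure IsBiharmonicSolution {n : ℕ} (g f v : Euc n → ℝ) : Prop where
  contDiffOn_ball : ContDiffOn ℝ 4 v (ball 0 1)
  contDiffOn_closedBall : ContDiffOn ℝ 1 v (closedBall 0 1)
  bilaplacian_eq : ∀ ξ ∈ ball (0 : Euc n) 1,
    Laplacian.laplacian (Laplacian.laplacian v) ξ = 0
  normalDeriv_eq : ∀ ξ ∈ sphere (0 : Euc n) 1, normalDeriv v ξ = g ξ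
  boundary_eq : ∀ ξ ∈ sphere (0 : Euc n) 1, v ξ = f ξ

end

/-!
Uniqueness. The difference `w` of two solutions is biharmonic in the ball `B`, is `C¹` up to the
boundary, and vanishes on the unit sphere together with its normal derivative. No control of second
derivatives at the boundary is available, so Green's identity cannot be applied on `B`; the maximum
principle is used instead. With `N` the dimension and `E w = Dw(x) x`, the function
`(2N - 8) w + 4 E w + (r² - |x|²) Δw` is harmonic in `B` for every constant `r`, because
`Δ E = E Δ + 2 Δ`, `Δ(|x|² u) = |x|² Δu + 4 E u + 2N u` and `Δ² w = 0`. On the sphere of radius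
`r < 1` it equals `(2N - 8) w + 4 E w`, which tends to `0` uniformly as `r → 1`. Hence
`(2N - 8) w + 4 E w + (1 - |x|²) Δw = 0` in `B` (`biharmonic_degenerate_equation`).
The substitution `w = (1 - |x|²) φ` turns this into `(1 - |x|²)² Δφ = 8 φ`, and `φ → 0` at the
boundary because `w` and its gradient vanish there. The sign of the zeroth order term excludes a
positive interior maximum and a negative interior minimum of `φ`, so `w = 0`
(`biharmonic_eq_zero`). The argument is carried out on `w` directly, comparing it with
`m (1 - |x|²)` for the maximum `m` of `φ`.

Existence. Write `Q = F(·, ω₀)²`, a quadratic polynomial positive on the closed ball (`poleSq`).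
From `|∇Q|² = 4 |ω₀|² Q` and `ΔQ = 2N |ω₀|²` it follows that `Q ^ ((2 - N) / 2)` is harmonic and
that the Laplacians of `Q ^ ((4 - N) / 2)` and, for `N = 4`, of `log Q` are multiples of it. The
stated formulas have the form `u + (1 - |ξ|²) h` with `u` biharmonic and `h` harmonic, hence are
biharmonic (`bilaplacian_add_one_sub_norm_sq_mul`). On the sphere they reduce to `u`, and
`z₀ = 2 ω₀ / (1 + |ω₀|²)` identifies this with the prescribed data (`abs_one_sub_inner_eq`).
-/

open InnerProductSpace Laplacian Filter Topology Module

/-! ### Calculus of the Laplacian -/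

section LaplacianCalculus

variable {E : Type*} [NormedAddCommGroup E] [InnerProductSpace ℝ E]
  {ι : Type*} [Fintype ι] {f g : E → ℝ} {x : E}

theorem ContDiffAt.differentiableAt_fderiv (hf : ContDiffAt ℝ 2 f x) :
    DifferentiableAt ℝ (fderiv ℝ f) x :=
  (hf.fderiv_right (m := 1) (by norm_num)).differentiableAt (by norm_num)

theorem ContDiffAt.eventually_differentiableAt (hf : ContDiffAt ℝ 2 f x) :
    ∀ᶠ y in 𝓝 x, DifferentiableAt ℝ f y :=
  (hf.eventually (by simp)).mono fun _ h => h.differentiableAt (by norm_num)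

theorem hasFDerivAt_norm_sq (x : E) :
    HasFDerivAt (fun y : E => ‖y‖ ^ 2) ((2 : ℝ) • innerSL ℝ x) x := by
  simpa [two_smul] using (hasStrictFDerivAt_norm_sq x).hasFDerivAt

theorem contDiff_norm_sq_real {m : WithTop ℕ∞} : ContDiff ℝ m fun y : E => ‖y‖ ^ 2 :=
  contDiff_norm_sq ℝ

theorem sum_inner_mul_apply (b : OrthonormalBasis ι ℝ E) (x : E) (l : E →L[ℝ] ℝ) :
    ∑ i, inner ℝ x (b i) * l (b i) = l x := by
  conv_rhs => rw [← b.sum_repr' x]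
  simp [real_inner_comm]

theorem fderiv_norm_sq_eq :
    fderiv ℝ (fun y : E => ‖y‖ ^ 2) = fun y => ((2 : ℝ) • innerSL ℝ : E →L[ℝ] E →L[ℝ] ℝ) y :=
  funext fun y => (hasFDerivAt_norm_sq y).fderiv

variable [FiniteDimensional ℝ E]

theorem laplacian_eq_sum_fderiv_fderiv (b : OrthonormalBasis ι ℝ E) (f : E → ℝ) (x : E) :
    Δ f x = ∑ i, fderiv ℝ (fderiv ℝ f) x (b i) (b i) := by
  rw [laplacian_eq_iteratedFDeriv_orthonormalBasis f b]
  simp [iteratedFDeriv_two_apply]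

theorem ContDiffAt.laplacian {m : WithTop ℕ∞} (hf : ContDiffAt ℝ (m + 2) f x) :
    ContDiffAt ℝ m (Δ f) x := by
  have h : Δ f = fun y => ∑ i, fderiv ℝ (fderiv ℝ f) y (stdOrthonormalBasis ℝ E i)
      (stdOrthonormalBasis ℝ E i) := funext (laplacian_eq_sum_fderiv_fderiv _ f)
  rw [h]
  have h1 : ContDiffAt ℝ (m + 1) (fderiv ℝ f) x :=
    hf.fderiv_right (by rw [add_assoc, one_add_one_eq_two])
  have h2 : ContDiffAt ℝ m (fderiv ℝ (fderiv ℝ f)) x := h1.fderiv_right le_rfl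
  exact ContDiffAt.sum fun i _ => (h2.clm_apply contDiffAt_const).clm_apply contDiffAt_const

theorem ContDiffAt.laplacian_mul (b : OrthonormalBasis ι ℝ E) (hf : ContDiffAt ℝ 2 f x)
    (hg : ContDiffAt ℝ 2 g x) :
    Δ (fun y => f y * g y) x = f x * Δ g x + g x * Δ f x
      + 2 * ∑ i, fderiv ℝ f x (b i) * fderiv ℝ g x (b i) := by
  have h1 : fderiv ℝ (fun y => f y * g y) =ᶠ[𝓝 x]
      fun y => f y • fderiv ℝ g y + g y • fderiv ℝ f y := by
    filter_upwards [hf.eventually_differentiableAt, hg.eventually_differentiableAt] with y h h'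
    exact fderiv_fun_mul h h'
  have hf1 := hf.differentiableAt (by norm_num)
  have hg1 := hg.differentiableAt (by norm_num)
  have h2 : ∀ v, fderiv ℝ (fderiv ℝ (fun y => f y * g y)) x v v
      = f x * fderiv ℝ (fderiv ℝ g) x v v + g x * fderiv ℝ (fderiv ℝ f) x v v
        + 2 * (fderiv ℝ f x v * fderiv ℝ g x v) := by
    intro v
    rw [h1.fderiv_eq, ((hf1.hasFDerivAt.fun_smul hg.differentiableAt_fderiv.hasFDerivAt).fun_add
      (hg1.hasFDerivAt.fun_smul hf.differentiableAt_fderiv.hasFDerivAt)).fderiv]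
    simp
    ring
  simp only [laplacian_eq_sum_fderiv_fderiv b, h2, Finset.sum_add_distrib, Finset.mul_sum]

theorem ContDiffAt.laplacian_comp (b : OrthonormalBasis ι ℝ E) {φ φ' : ℝ → ℝ} {φ'' : ℝ}
    (hf : ContDiffAt ℝ 2 f x) (hφ : ∀ᶠ t in 𝓝 (f x), HasDerivAt φ (φ' t) t)
    (hφ' : HasDerivAt φ' φ'' (f x)) :
    Δ (fun y => φ (f y)) x = φ' (f x) * Δ f x + φ'' * ∑ i, fderiv ℝ f x (b i) ^ 2 := by
  have hf1 := hf.differentiableAt (by norm_num)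
  have h1 : fderiv ℝ (fun y => φ (f y)) =ᶠ[𝓝 x] fun y => φ' (f y) • fderiv ℝ f y := by
    filter_upwards [hf.eventually_differentiableAt, hf1.continuousAt.eventually hφ] with y h h'
    exact (h'.comp_hasFDerivAt y h.hasFDerivAt).fderiv
  have h2 : ∀ v, fderiv ℝ (fderiv ℝ (fun y => φ (f y))) x v v
      = φ' (f x) * fderiv ℝ (fderiv ℝ f) x v v + φ'' * fderiv ℝ f x v ^ 2 := by
    intro v
    have hc : HasFDerivAt (fun y => φ' (f y)) (φ'' • fderiv ℝ f x) x :=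
      hφ'.comp_hasFDerivAt x hf1.hasFDerivAt
    rw [h1.fderiv_eq, (hc.fun_smul hf.differentiableAt_fderiv.hasFDerivAt).fderiv]
    simp
    ring
  simp only [laplacian_eq_sum_fderiv_fderiv b, h2, Finset.sum_add_distrib, Finset.mul_sum]

theorem laplacian_norm_sq (x : E) : Δ (fun y : E => ‖y‖ ^ 2) x = 2 * finrank ℝ E := by
  rw [laplacian_eq_sum_fderiv_fderiv (stdOrthonormalBasis ℝ E), fderiv_norm_sq_eq,
    ContinuousLinearMap.fderiv]
  have h : ∀ i, ((2 : ℝ) • innerSL ℝ : E →L[ℝ] E →L[ℝ] ℝ) (stdOrthonormalBasis ℝ E i)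
      (stdOrthonormalBasis ℝ E i) = 2 := fun i => by
    change (2 : ℝ) * inner ℝ (stdOrthonormalBasis ℝ E i) (stdOrthonormalBasis ℝ E i) = 2
    simp
  simp only [h]
  simp [mul_comm]

theorem ContDiffAt.laplacian_norm_sq_mul (hf : ContDiffAt ℝ 2 f x) :
    Δ (fun y => ‖y‖ ^ 2 * f y) x
      = ‖x‖ ^ 2 * Δ f x + 2 * finrank ℝ E * f x + 4 * fderiv ℝ f x x := by
  rw [contDiff_norm_sq_real.contDiffAt.laplacian_mul (stdOrthonormalBasis ℝ E) hf,
    laplacian_norm_sq, (hasFDerivAt_norm_sq x).fderiv]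
  have h := sum_inner_mul_apply (stdOrthonormalBasis ℝ E) x (fderiv ℝ f x)
  simp only [smul_apply, innerSL_apply_apply, smul_eq_mul, mul_assoc,
    ← Finset.mul_sum, h]
  ring

/-- The Euler operator `f ↦ Df(y) y` satisfies `[Δ, E] = 2 Δ`; in particular it preserves
harmonicity. -/
theorem ContDiffAt.laplacian_fderiv_self (hf : ContDiffAt ℝ 3 f x) :
    Δ (fun y => fderiv ℝ f y y) x = fderiv ℝ (Δ f) x x + 2 * Δ f x := by
  have hf2 : ContDiffAt ℝ 2 (fderiv ℝ f) x := hf.fderiv_right (by norm_num)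
  have hf1 : ContDiffAt ℝ 1 (fderiv ℝ (fderiv ℝ f)) x := hf2.fderiv_right (by norm_num)
  have hd1 : DifferentiableAt ℝ (fderiv ℝ f) x := hf2.differentiableAt (by norm_num)
  have hd2 : DifferentiableAt ℝ (fderiv ℝ (fderiv ℝ f)) x := hf1.differentiableAt (by norm_num)
  have hid : ∀ y, HasFDerivAt (fun y : E => y) (ContinuousLinearMap.id ℝ E) y := hasFDerivAt_id
  have hev : ∀ᶠ y in 𝓝 x, ContDiffAt ℝ 3 f y := hf.eventually (by simp)
  -- By symmetry of the second derivative, `D(y ↦ Df(y) y) = D²f(y) y + Df(y)` as a linear form,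
  -- which can be differentiated once more without naming a direction.
  have hflip : fderiv ℝ (fun y => fderiv ℝ f y y) =ᶠ[𝓝 x]
      fun y => fderiv ℝ (fderiv ℝ f) y y + fderiv ℝ f y := by
    filter_upwards [hev] with y hy
    have hy1 : DifferentiableAt ℝ (fderiv ℝ f) y :=
      (hy.fderiv_right (m := 2) (by norm_num)).differentiableAt (by norm_num)
    have hs : IsSymmSndFDerivAt ℝ f y := hy.isSymmSndFDerivAt (by simp; norm_num)
    rw [(hy1.hasFDerivAt.clm_apply (hid y)).fderiv]
    ext v
    simp [hs v y, add_comm]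
  have hs3 : IsSymmSndFDerivAt ℝ (fderiv ℝ f) x := hf2.isSymmSndFDerivAt (by simp)
  have key : ∀ v, fderiv ℝ (fderiv ℝ (fun y => fderiv ℝ f y y)) x v v
      = fderiv ℝ (fderiv ℝ (fderiv ℝ f)) x x v v + 2 * fderiv ℝ (fderiv ℝ f) x v v := by
    intro v
    rw [hflip.fderiv_eq, ((hd2.hasFDerivAt.clm_apply (hid x)).fun_add
      hd1.hasFDerivAt).fderiv]
    simp [hs3 v x]
    ring
  have hL : fderiv ℝ (Δ f) x x = ∑ i, fderiv ℝ (fderiv ℝ (fderiv ℝ f)) x x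
      (stdOrthonormalBasis ℝ E i) (stdOrthonormalBasis ℝ E i) := by
    have h : Δ f = fun y => ∑ i, fderiv ℝ (fderiv ℝ f) y (stdOrthonormalBasis ℝ E i)
      (stdOrthonormalBasis ℝ E i) := funext (laplacian_eq_sum_fderiv_fderiv _ f)
    rw [h, (HasFDerivAt.fun_sum fun i _ => ((hd2.hasFDerivAt.clm_apply
      (hasFDerivAt_const (stdOrthonormalBasis ℝ E i) x)).clm_apply
      (hasFDerivAt_const (stdOrthonormalBasis ℝ E i) x))).fderiv]
    simp
  rw [hL, laplacian_eq_sum_fderiv_fderiv (stdOrthonormalBasis ℝ E),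
    laplacian_eq_sum_fderiv_fderiv (stdOrthonormalBasis ℝ E)]
  simp only [key, Finset.sum_add_distrib, Finset.mul_sum]

theorem IsLocalMax.deriv_deriv_nonpos {h : ℝ → ℝ} {t : ℝ} (hm : IsLocalMax h t)
    (hc : ContinuousAt h t) : deriv (deriv h) t ≤ 0 := by
  by_contra! hpos
  have hmin := isLocalMin_of_deriv_deriv_pos hpos hm.deriv_eq_zero hc
  have hconst : h =ᶠ[𝓝 t] fun _ => h t := by
    filter_upwards [hm, hmin] with s h1 h2 using le_antisymm h1 h2
  have : deriv (deriv h) t = 0 := by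
    rw [hconst.deriv.deriv_eq]; simp
  linarith

/-- Reduces to the second derivative along each vector of an orthonormal basis. -/
theorem IsLocalMax.laplacian_nonpos (hm : IsLocalMax f x) (hf : ContDiffAt ℝ 2 f x) :
    Δ f x ≤ 0 := by
  rw [laplacian_eq_sum_fderiv_fderiv (stdOrthonormalBasis ℝ E)]
  refine Finset.sum_nonpos fun i _ => ?_
  set v := stdOrthonormalBasis ℝ E i
  have hl : ∀ t : ℝ, HasDerivAt (fun t : ℝ => x + t • v) v t := fun t => by
    simpa using ((hasDerivAt_id t).smul_const v).const_add x
  have hc : ContinuousAt (fun t : ℝ => x + t • v) 0 := (hl 0).continuousAt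
  have ht : Tendsto (fun t : ℝ => x + t • v) (𝓝 0) (𝓝 x) := by simpa [ContinuousAt] using hc
  have hm' : IsLocalMax (fun t : ℝ => f (x + t • v)) 0 := by
    have := ht.eventually hm
    simpa [IsLocalMax, IsMaxFilter] using this
  have hcont : ContinuousAt (fun t : ℝ => f (x + t • v)) 0 :=
    ContinuousAt.comp (g := f) (by simpa using hf.continuousAt) hc
  have hd : deriv (fun t : ℝ => f (x + t • v)) =ᶠ[𝓝 0] fun t => fderiv ℝ f (x + t • v) v := by
    filter_upwards [ht.eventually hf.eventually_differentiableAt] with t h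
    exact (h.hasFDerivAt.comp_hasDerivAt t (hl t)).deriv
  have hdd : deriv (deriv (fun t : ℝ => f (x + t • v))) 0 = fderiv ℝ (fderiv ℝ f) x v v := by
    rw [hd.deriv_eq]
    have h0 : HasFDerivAt (fderiv ℝ f) (fderiv ℝ (fderiv ℝ f) x) (x + (0 : ℝ) • v) := by
      simpa using hf.differentiableAt_fderiv.hasFDerivAt
    have h1 : HasDerivAt (fun t : ℝ => fderiv ℝ f (x + t • v)) (fderiv ℝ (fderiv ℝ f) x v) 0 :=
      h0.comp_hasDerivAt (0 : ℝ) (hl 0)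
    simpa using (h1.clm_apply (hasDerivAt_const (0 : ℝ) v)).deriv
  exact hdd ▸ hm'.deriv_deriv_nonpos hcont

end LaplacianCalculus

/-! ### Uniqueness for the biharmonic Dirichlet problem -/

section Uniqueness

variable {E : Type*} [NormedAddCommGroup E] [InnerProductSpace ℝ E]

theorem uniqueDiffOn_unit_closedBall : UniqueDiffOn ℝ (closedBall (0 : E) 1) :=
  uniqueDiffOn_convex (convex_closedBall 0 1)
    ⟨0, ball_subset_interior_closedBall (mem_ball_self one_pos)⟩

variable [FiniteDimensional ℝ E]

/-- Weak maximum principle for subharmonic functions on a ball. -/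
theorem le_of_laplacian_nonneg [Nontrivial E] {f : E → ℝ} {r M : ℝ} (hr : 0 ≤ r)
    (hc : ContinuousOn f (closedBall 0 r)) (hf : ∀ x ∈ ball (0 : E) r, ContDiffAt ℝ 2 f x)
    (hΔ : ∀ x ∈ ball (0 : E) r, 0 ≤ Δ f x) (hM : ∀ x ∈ sphere (0 : E) r, f x ≤ M) :
    ∀ x ∈ closedBall (0 : E) r, f x ≤ M := by
  intro x hx
  -- Adding `ε ‖y‖²` makes the Laplacian positive, which excludes an interior maximum.
  have hε : ∀ ε > 0, f x ≤ M + ε * r ^ 2 := by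
    intro ε hε
    obtain ⟨y, hy, hmax⟩ := (isCompact_closedBall (0 : E) r).exists_isMaxOn
      ⟨0, by simpa using hr⟩ (hc.add ((contDiff_norm_sq_real (E := E)
        (m := 0)).continuous.continuousOn.const_smul ε))
    have hys : y ∈ sphere (0 : E) r := by
      by_contra hns
      have hyb : y ∈ ball (0 : E) r := by
        rw [mem_ball_zero_iff]; rw [mem_closedBall_zero_iff] at hy
        exact lt_of_le_of_ne hy (by simpa using hns)
      have hloc := hmax.isLocalMax (closedBall_mem_nhds_of_mem hyb)
      have h2 : ContDiffAt ℝ 2 (fun y : E => ‖y‖ ^ 2) y := contDiff_norm_sq_real.contDiffAt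
      have h0 := hloc.laplacian_nonpos ((hf y hyb).add (h2.const_smul ε))
      have h1 := (hf y hyb).laplacian_add (h2.const_smul ε)
      have h3 := laplacian_smul ε h2
      rw [laplacian_norm_sq, smul_eq_mul] at h3
      have h4 : (0 : ℝ) < finrank ℝ E := by exact_mod_cast finrank_pos
      have h5 := hΔ y hyb
      have h6 : 0 < ε * (2 * finrank ℝ E) := by positivity
      have h7 : Δ (f + ε • fun y : E => ‖y‖ ^ 2) y ≤ 0 := h0
      have h8 : Δ (f + ε • fun y : E => ‖y‖ ^ 2) y = Δ f y + Δ (ε • fun y : E => ‖y‖ ^ 2) y := h1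
      linarith
    have h1 : f x + ε * ‖x‖ ^ 2 ≤ f y + ε * ‖y‖ ^ 2 := hmax hx
    have h2 : ‖y‖ = r := by simpa using hys
    have h3 := hM y hys
    have h4 : 0 ≤ ε * ‖x‖ ^ 2 := by positivity
    rw [h2] at h1
    linarith
  refine le_of_forall_pos_le_add fun δ hδ => ?_
  have h := hε (δ / (r ^ 2 + 1)) (by positivity)
  have : δ / (r ^ 2 + 1) * r ^ 2 ≤ δ := by
    rw [div_mul_eq_mul_div, div_le_iff₀ (by positivity)]
    nlinarith
  linarith

theorem exists_abs_lt_of_eq_zero_on_sphere {g : E → ℝ} (hg : ContinuousOn g (closedBall 0 1))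
    (h0 : ∀ x ∈ sphere (0 : E) 1, g x = 0) {ε : ℝ} (hε : 0 < ε) :
    ∃ δ < 1, ∀ x ∈ closedBall (0 : E) 1, δ < ‖x‖ → |g x| < ε := by
  set K : Set E := closedBall (0 : E) 1 ∩ (fun x => |g x|) ⁻¹' Set.Ici ε
  have hK : IsCompact K := (isCompact_closedBall (0 : E) 1).of_isClosed_subset
    (hg.abs.preimage_isClosed_of_isClosed isClosed_closedBall isClosed_Ici) Set.inter_subset_left
  rcases K.eq_empty_or_nonempty with hE | hne
  · refine ⟨0, one_pos, fun x hx _ => ?_⟩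
    by_contra! h
    have : x ∈ K := ⟨hx, h⟩
    simp [hE] at this
  · obtain ⟨y, hy, hmax⟩ := hK.exists_isMaxOn hne continuous_norm.continuousOn
    refine ⟨‖y‖, ?_, fun x hx hlt => ?_⟩
    · refine lt_of_le_of_ne (by simpa using hy.1) fun h1 => ?_
      have h2 : ε ≤ |g y| := hy.2
      rw [h0 y (by simpa using h1), abs_zero] at h2
      linarith
    · by_contra! h
      exact absurd (hmax (show x ∈ K from ⟨hx, h⟩)) (not_le.2 hlt)

/-- A biharmonic function with zero Dirichlet data satisfies a second order equation that
degenerates on the unit sphere. With `N` the dimension,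
`(2N - 8) w + 4 Dw(x) x + (r² - ‖x‖²) Δw` is harmonic for every constant `r`, and on the sphere of
radius `r` it reduces to its first two terms, which tend to `0` uniformly as `r → 1`. -/
theorem biharmonic_degenerate_equation [Nontrivial E] {w : E → ℝ}
    (hw : ContDiffOn ℝ 4 w (ball 0 1))
    (hw1 : ContDiffOn ℝ 1 w (closedBall 0 1)) (hΔ : ∀ x ∈ ball (0 : E) 1, Δ (Δ w) x = 0)
    (h0 : ∀ x ∈ sphere (0 : E) 1, w x = 0)
    (hη : ∀ x ∈ sphere (0 : E) 1, fderivWithin ℝ w (closedBall 0 1) x x = 0) :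
    ∀ x ∈ ball (0 : E) 1,
      (2 * finrank ℝ E - 8) * w x + 4 * fderiv ℝ w x x + (1 - ‖x‖ ^ 2) * Δ w x = 0 := by
  set N : ℝ := (finrank ℝ E : ℝ)
  have hat : ∀ x ∈ ball (0 : E) 1, ContDiffAt ℝ 4 w x := fun x hx =>
    hw.contDiffAt (isOpen_ball.mem_nhds hx)
  -- On the sphere of radius `r`, `H (r ^ 2)` no longer involves `Δ w`, which is not known to be
  -- bounded near the unit sphere, but `H s` is harmonic for every constant `s`.
  set H : ℝ → E → ℝ := fun s x =>
    (2 * N - 8) * w x + 4 * fderiv ℝ w x x + (s * Δ w x - ‖x‖ ^ 2 * Δ w x) with hH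
  have hpieces : ∀ x ∈ ball (0 : E) 1, ContDiffAt ℝ 2 w x ∧
      ContDiffAt ℝ 2 (fun y => fderiv ℝ w y y) x ∧ ContDiffAt ℝ 2 (Δ w) x := fun x hx =>
    ⟨(hat x hx).of_le (by norm_num),
      (((hat x hx).fderiv_right (m := 3) (by norm_num)).of_le (by norm_num)).clm_apply
        contDiffAt_id, ContDiffAt.laplacian ((hat x hx).of_le (by norm_num))⟩
  have hHC : ∀ s, ∀ x ∈ ball (0 : E) 1, ContDiffAt ℝ 2 (H s) x := fun s x hx => by
    obtain ⟨h1, h2, h3⟩ := hpieces x hx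
    exact ((contDiffAt_const.mul h1).add (contDiffAt_const.mul h2)).add
      ((contDiffAt_const.mul h3).sub (contDiff_norm_sq_real.contDiffAt.mul h3))
  have hHΔ : ∀ s, ∀ x ∈ ball (0 : E) 1, Δ (H s) x = 0 := fun s x hx => by
    obtain ⟨h1, h2, h3⟩ := hpieces x hx
    have h4 : ContDiffAt ℝ 2 (fun y => ‖y‖ ^ 2 * Δ w y) x :=
      contDiff_norm_sq_real.contDiffAt.mul h3
    have e : H s = ((2 * N - 8) • w + (4 : ℝ) • fun y => fderiv ℝ w y y)
        + (s • Δ w - fun y => ‖y‖ ^ 2 * Δ w y) := rfl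
    have k1 : ContDiffAt ℝ 2 ((2 * N - 8) • w) x := h1.const_smul (2 * N - 8)
    have k2 : ContDiffAt ℝ 2 ((4 : ℝ) • fun y => fderiv ℝ w y y) x := h2.const_smul (4 : ℝ)
    have k3 : ContDiffAt ℝ 2 (s • Δ w) x := h3.const_smul s
    have k12 : ContDiffAt ℝ 2 ((2 * N - 8) • w + (4 : ℝ) • fun y => fderiv ℝ w y y) x := k1.add k2
    have k34 : ContDiffAt ℝ 2 (s • Δ w - fun y => ‖y‖ ^ 2 * Δ w y) x := k3.sub h4
    rw [e, k12.laplacian_add k34, k1.laplacian_add k2, k3.laplacian_sub h4,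
      laplacian_smul _ h1, laplacian_smul _ h2, laplacian_smul _ h3,
      ((hat x hx).of_le (by norm_num)).laplacian_fderiv_self, h3.laplacian_norm_sq_mul, hΔ x hx]
    simp only [smul_eq_mul]
    ring
  have hsmall : ∀ ε > 0, ∃ δ < 1, ∀ s, ∀ r, 0 ≤ r → δ < r → r < 1 → s = r ^ 2 →
      ∀ x ∈ closedBall (0 : E) r, H s x ≤ ε ∧ - H s x ≤ ε := by
    intro ε hε
    have hB : ContinuousOn (fun x => (2 * N - 8) * w x
        + 4 * fderivWithin ℝ w (closedBall 0 1) x x) (closedBall (0 : E) 1) :=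
      (continuousOn_const.mul hw1.continuousOn).add (continuousOn_const.mul
        ((hw1.continuousOn_fderivWithin uniqueDiffOn_unit_closedBall le_rfl).clm_apply
          continuousOn_id))
    obtain ⟨δ, hδ, hsm⟩ := exists_abs_lt_of_eq_zero_on_sphere hB
      (fun x hx => by simp [h0 x hx, hη x hx]) hε
    refine ⟨δ, hδ, fun s r hr0 hr hr1 hs => ?_⟩
    have hsub : closedBall (0 : E) r ⊆ ball 0 1 := closedBall_subset_ball hr1
    have hsph : ∀ x ∈ sphere (0 : E) r, |H s x| < ε := fun x hx => by
      have hxn : ‖x‖ = r := by simpa using hx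
      have hxb : x ∈ ball (0 : E) 1 := hsub (sphere_subset_closedBall hx)
      have := hsm x (ball_subset_closedBall hxb) (by rw [hxn]; exact hr)
      rw [fderivWithin_of_mem_nhds (closedBall_mem_nhds_of_mem hxb)] at this
      simpa [hH, hs, hxn] using this
    intro x hx
    refine ⟨le_of_laplacian_nonneg hr0
      (fun y hy => (hHC s y (hsub hy)).continuousAt.continuousWithinAt)
      (fun y hy => hHC s y (hsub (ball_subset_closedBall hy)))
      (fun y hy => (hHΔ s y (hsub (ball_subset_closedBall hy))).ge)
      (fun y hy => (abs_lt.1 (hsph y hy)).2.le) x hx,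
      le_of_laplacian_nonneg (f := -H s) hr0
      (fun y hy => (hHC s y (hsub hy)).neg.continuousAt.continuousWithinAt)
      (fun y hy => (hHC s y (hsub (ball_subset_closedBall hy))).neg)
      (fun y hy => by
        rw [laplacian_neg, Pi.neg_apply, hHΔ s y (hsub (ball_subset_closedBall hy)), neg_zero])
      (fun y hy => neg_le.1 (abs_lt.1 (hsph y hy)).1.le) x hx⟩
  intro x hx
  have hx1 : ‖x‖ < 1 := by simpa using hx
  have hlim : Tendsto (fun r : ℝ => H (r ^ 2) x) (𝓝[<] 1) (𝓝 (H 1 x)) := by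
    have : Continuous fun r : ℝ => H (r ^ 2) x := by
      simp only [hH]; fun_prop
    simpa using (this.tendsto 1).mono_left nhdsWithin_le_nhds
  have hfin : ∀ ε > 0, H 1 x ≤ ε ∧ - H 1 x ≤ ε := by
    intro ε hε
    obtain ⟨δ, hδ, h⟩ := hsmall ε hε
    have hev : ∀ᶠ r : ℝ in 𝓝[<] 1, H (r ^ 2) x ≤ ε ∧ - H (r ^ 2) x ≤ ε := by
      filter_upwards [Ioo_mem_nhdsLT (max_lt hδ hx1)] with r hr
      have h1 := (le_max_left _ _).trans_lt hr.1
      have h2 := (le_max_right _ _).trans_lt hr.1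
      exact h _ r ((norm_nonneg x).trans h2.le) h1 hr.2 rfl x (by simpa using h2.le)
    exact ⟨le_of_tendsto hlim (hev.mono fun _ h => h.1),
      le_of_tendsto hlim.neg (hev.mono fun _ h => h.2)⟩
  have hz : H 1 x = 0 := le_antisymm (le_of_forall_pos_le_add fun ε hε => by
    simpa using (hfin ε hε).1) (by
      have := le_of_forall_pos_le_add (a := - H 1 x) (b := 0) fun ε hε => by
        simpa using (hfin ε hε).2
      linarith)
  rw [← hz]
  simp only [hH]
  ring

/-- The upper half of `w = o(1 - ‖x‖²)` at the unit sphere, for a `C¹` function with zero Dirichlet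
data, by the mean value theorem along rays. -/
theorem exists_le_mul_one_sub_norm_sq {w : E → ℝ} (hw1 : ContDiffOn ℝ 1 w (closedBall 0 1))
    (h0 : ∀ x ∈ sphere (0 : E) 1, w x = 0)
    (hη : ∀ x ∈ sphere (0 : E) 1, fderivWithin ℝ w (closedBall 0 1) x x = 0)
    {ε : ℝ} (hε : 0 < ε) :
    ∃ δ < 1, ∀ x ∈ ball (0 : E) 1, δ < ‖x‖ → w x ≤ ε * (1 - ‖x‖ ^ 2) := by
  have hB : ContinuousOn (fun x => fderivWithin ℝ w (closedBall 0 1) x x) (closedBall (0 : E) 1) :=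
    (hw1.continuousOn_fderivWithin uniqueDiffOn_unit_closedBall le_rfl).clm_apply
      continuousOn_id
  obtain ⟨δ, hδ, hsm⟩ := exists_abs_lt_of_eq_zero_on_sphere hB hη (half_pos hε)
  refine ⟨max δ (1 / 2), max_lt hδ (by norm_num), fun x hx hxδ => ?_⟩
  have hδx := (le_max_left _ _).trans_lt hxδ
  have hx2 := (le_max_right _ _).trans_lt hxδ
  set s := ‖x‖ with hs
  have hs1 : s < 1 := by simpa using hx
  have hs0 : 0 < s := by linarith
  set θ := s⁻¹ • x with hθ
  have hθn : ‖θ‖ = 1 := by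
    rw [hθ, norm_smul, norm_inv, Real.norm_of_nonneg hs0.le, ← hs, inv_mul_cancel₀ hs0.ne']
  have hsθ : s • θ = x := by rw [hθ, smul_smul, mul_inv_cancel₀ hs0.ne', one_smul]
  have hmem : ∀ t ∈ Set.Icc s 1, t • θ ∈ closedBall (0 : E) 1 := fun t ht => by
    rw [mem_closedBall_zero_iff, norm_smul, hθn, mul_one, Real.norm_of_nonneg (hs0.le.trans ht.1)]
    exact ht.2
  have hcont : ContinuousOn (fun t : ℝ => w (t • θ)) (Set.Icc s 1) :=
    hw1.continuousOn.comp (by fun_prop) hmem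
  have hderiv : ∀ t ∈ Set.Ioo s 1, HasDerivAt (fun t : ℝ => w (t • θ)) (fderiv ℝ w (t • θ) θ) t :=
    fun t ht => by
      have hb : t • θ ∈ ball (0 : E) 1 := by
        rw [mem_ball_zero_iff, norm_smul, hθn, mul_one,
          Real.norm_of_nonneg (hs0.le.trans ht.1.le)]
        exact ht.2
      have hd : DifferentiableAt ℝ w (t • θ) :=
        (hw1.contDiffAt (closedBall_mem_nhds_of_mem hb)).differentiableAt (by norm_num)
      have hl : HasDerivAt (fun t : ℝ => t • θ) θ t := by
        simpa using (hasDerivAt_id t).smul_const θ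
      exact hd.hasFDerivAt.comp_hasDerivAt t hl
  obtain ⟨t, ht, hslope⟩ := exists_hasDerivAt_eq_slope _ _ hs1 hcont hderiv
  have htb : t • θ ∈ ball (0 : E) 1 := by
    rw [mem_ball_zero_iff, norm_smul, hθn, mul_one, Real.norm_of_nonneg (hs0.le.trans ht.1.le)]
    exact ht.2
  have htn : ‖t • θ‖ = t := by
    rw [norm_smul, hθn, mul_one, Real.norm_of_nonneg (hs0.le.trans ht.1.le)]
  have hb := hsm (t • θ) (ball_subset_closedBall htb) (by rw [htn]; exact hδx.trans ht.1)
  rw [fderivWithin_of_mem_nhds (closedBall_mem_nhds_of_mem htb), map_smul, smul_eq_mul,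
    hslope, one_smul, hsθ, h0 θ (by simpa using hθn)] at hb
  have h1s : 0 < 1 - s := by linarith
  have h2 := (abs_lt.1 hb).1
  have h3 : t * ((0 - w x) / (1 - s)) * (1 - s) = - (t * w x) := by
    field_simp
    ring
  have h4 : t * w x < ε / 2 * (1 - s) := by nlinarith
  have ht2 : 1 / 2 < t := hx2.trans ht.1
  by_contra! hcon
  have h5 : 0 < ε * (1 - s ^ 2) := by
    have : 0 < 1 - s ^ 2 := by nlinarith
    positivity
  nlinarith [mul_pos hε h1s, mul_pos (mul_pos hε h1s) hs0]

/-- If `w` were positive somewhere, `w / (1 - ‖x‖²)` would attain a maximum `m > 0` at some interior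
point. There `w - m (1 - ‖x‖²)` has a local maximum, and inserting the resulting values of `w` and
`Dw(x) x` and the bound for `Δw` into `biharmonic_degenerate_equation` gives `0 ≤ -8 m`. -/
theorem biharmonic_le_zero [Nontrivial E] {w : E → ℝ} (hw : ContDiffOn ℝ 4 w (ball 0 1))
    (hw1 : ContDiffOn ℝ 1 w (closedBall 0 1)) (hΔ : ∀ x ∈ ball (0 : E) 1, Δ (Δ w) x = 0)
    (h0 : ∀ x ∈ sphere (0 : E) 1, w x = 0)
    (hη : ∀ x ∈ sphere (0 : E) 1, fderivWithin ℝ w (closedBall 0 1) x x = 0) :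
    ∀ x ∈ ball (0 : E) 1, w x ≤ 0 := by
  intro x₀ hx₀
  by_contra! hpos
  have hρ : ∀ x ∈ ball (0 : E) 1, 0 < 1 - ‖x‖ ^ 2 := fun x hx => by
    have : ‖x‖ < 1 := by simpa using hx
    nlinarith [norm_nonneg x]
  have hm₀ : 0 < w x₀ / (1 - ‖x₀‖ ^ 2) := div_pos hpos (hρ x₀ hx₀)
  obtain ⟨δ, hδ, hsm⟩ := exists_le_mul_one_sub_norm_sq hw1 h0 hη (half_pos hm₀)
  have hx₀δ : ‖x₀‖ ≤ δ := by
    by_contra! h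
    have h1 := hsm x₀ hx₀ h
    rw [div_div, div_mul_eq_mul_div, mul_comm (1 - ‖x₀‖ ^ 2), ← div_div, mul_div_right_comm,
      mul_div_cancel_right₀ _ (hρ x₀ hx₀).ne'] at h1
    linarith
  have hsub : closedBall (0 : E) δ ⊆ ball 0 1 := closedBall_subset_ball hδ
  obtain ⟨y, hy, hmax⟩ := (isCompact_closedBall (0 : E) δ).exists_isMaxOn
    ⟨x₀, by simpa using hx₀δ⟩ ((hw1.continuousOn.mono (hsub.trans ball_subset_closedBall)).div
      ((continuousOn_const (c := (1 : ℝ))).sub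
        (contDiff_norm_sq_real (E := E) (m := 0)).continuous.continuousOn)
      (fun x hx => (hρ x (hsub hx)).ne'))
  -- `m` is the maximum of `w / (1 - ‖x‖²)` over the whole ball, attained at the interior point `y`.
  set m := w y / (1 - ‖y‖ ^ 2) with hm
  have hyb := hsub hy
  have hmm : w x₀ / (1 - ‖x₀‖ ^ 2) ≤ m := hmax (by simpa using hx₀δ)
  have hmpos : 0 < m := hm₀.trans_le hmm
  have hwy : w y = m * (1 - ‖y‖ ^ 2) := by rw [hm, div_mul_cancel₀ _ (hρ y hyb).ne']
  have hle : ∀ x ∈ ball (0 : E) 1, w x ≤ m * (1 - ‖x‖ ^ 2) := fun x hx => by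
    rcases le_or_gt ‖x‖ δ with h | h
    · exact (div_le_iff₀ (hρ x hx)).1 (hmax (by simpa using h))
    · exact (hsm x hx h).trans (mul_le_mul_of_nonneg_right (by linarith) (hρ x hx).le)
  have hmax' : IsLocalMax (w + m • fun x : E => ‖x‖ ^ 2) y := by
    filter_upwards [isOpen_ball.mem_nhds hyb] with x hx
    have := hle x hx
    simp only [Pi.add_apply, Pi.smul_apply, smul_eq_mul, hwy]
    linarith
  have hcw : ContDiffAt ℝ 4 w y := hw.contDiffAt (isOpen_ball.mem_nhds hyb)
  have hcw2 : ContDiffAt ℝ 2 w y := hcw.of_le (by norm_num)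
  have hcn : ContDiffAt ℝ 2 (fun x : E => ‖x‖ ^ 2) y := contDiff_norm_sq_real.contDiffAt
  have h2 := hmax'.laplacian_nonpos (hcw2.add (hcn.const_smul m))
  have h4 : Δ (w + m • fun x : E => ‖x‖ ^ 2) y = Δ w y + Δ (m • fun x : E => ‖x‖ ^ 2) y :=
    hcw2.laplacian_add (hcn.const_smul m)
  rw [h4, laplacian_smul m hcn, laplacian_norm_sq, smul_eq_mul] at h2
  have h1 := hmax'.hasFDerivAt_eq_zero ((hcw2.differentiableAt (by norm_num)).hasFDerivAt.add
    ((hasFDerivAt_norm_sq y).const_smul m))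
  have h1' := DFunLike.congr_fun h1 y
  simp only [add_apply, smul_apply, innerSL_apply_apply, real_inner_self_eq_norm_sq,
    smul_eq_mul, zero_apply] at h1'
  have heq := biharmonic_degenerate_equation hw hw1 hΔ h0 hη y hyb
  have h3 : (1 - ‖y‖ ^ 2) * Δ w y ≤ (1 - ‖y‖ ^ 2) * (-(m * (2 * finrank ℝ E))) :=
    mul_le_mul_of_nonneg_left (by linarith) (hρ y hyb).le
  rw [hwy] at heq
  nlinarith

theorem biharmonic_eq_zero [Nontrivial E] {w : E → ℝ} (hw : ContDiffOn ℝ 4 w (ball 0 1))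
    (hw1 : ContDiffOn ℝ 1 w (closedBall 0 1)) (hΔ : ∀ x ∈ ball (0 : E) 1, Δ (Δ w) x = 0)
    (h0 : ∀ x ∈ sphere (0 : E) 1, w x = 0)
    (hη : ∀ x ∈ sphere (0 : E) 1, fderivWithin ℝ w (closedBall 0 1) x x = 0) :
    ∀ x ∈ closedBall (0 : E) 1, w x = 0 := by
  intro x hx
  rcases (show ‖x‖ ≤ 1 by simpa using hx).lt_or_eq with h | h
  · have hxb : x ∈ ball (0 : E) 1 := by simpa using h
    refine le_antisymm (biharmonic_le_zero hw hw1 hΔ h0 hη x hxb) ?_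
    have := biharmonic_le_zero (w := -w) hw.neg hw1.neg
      (fun x hx => by rw [laplacian_neg, laplacian_neg, Pi.neg_apply, hΔ x hx, neg_zero])
      (fun x hx => by simp [h0 x hx])
      (fun x hx => by
        have h := fderivWithin_neg (𝕜 := ℝ) (f := w) (uniqueDiffOn_unit_closedBall x
          (sphere_subset_closedBall hx))
        simp [h, hη x hx]) x hxb
    simpa using this
  · exact h0 x (by simpa using h)

end Uniqueness

/-! ### Biharmonic functions with a pole outside the ball -/

section ReflectedPole

variable {E : Type*} [NormedAddCommGroup E] [InnerProductSpace ℝ E]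

/-- `1 - 2⟨ω, ξ⟩ + |ω|²|ξ|²`, the square of `F ξ ω` written as a polynomial in `ξ`. For `ω ≠ 0` it
is `|ω|²` times the squared distance from `ξ` to the point `ω / |ω|²` inverse to `ω` in the unit
sphere. -/
def poleSq (ω ξ : E) : ℝ := 1 - 2 * inner ℝ ω ξ + ‖ω‖ ^ 2 * ‖ξ‖ ^ 2

theorem poleSq_pos {ω ξ : E} (hω : ‖ω‖ < 1) (hξ : ‖ξ‖ ≤ 1) : 0 < poleSq ω ξ := by
  have h1 := real_inner_le_norm ω ξ
  have h2 : ‖ω‖ * ‖ξ‖ < 1 := by nlinarith [norm_nonneg ω, norm_nonneg ξ]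
  unfold poleSq
  nlinarith [mul_pos (sub_pos.2 h2) (sub_pos.2 h2)]

theorem contDiff_poleSq {m : WithTop ℕ∞} (ω : E) : ContDiff ℝ m (poleSq ω) :=
  (contDiff_const.sub (contDiff_const.mul (contDiff_const.inner ℝ contDiff_id))).add
    (contDiff_const.mul contDiff_norm_sq_real)

theorem hasFDerivAt_poleSq (ω ξ : E) :
    HasFDerivAt (poleSq ω) (innerSL ℝ ((2 * ‖ω‖ ^ 2) • ξ - (2 : ℝ) • ω)) ξ := by
  have h := (((innerSL ℝ ω).hasFDerivAt (x := ξ)).const_mul 2).const_sub 1 |>.fun_add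
    ((hasFDerivAt_norm_sq ξ).const_mul (‖ω‖ ^ 2))
  refine h.congr_fderiv ?_
  ext v
  simp
  ring

theorem contDiffAt_poleSq_rpow {m : WithTop ℕ∞} (p : ℝ) {ω ξ : E} (h : 0 < poleSq ω ξ) :
    ContDiffAt ℝ m (fun y => poleSq ω y ^ p) ξ :=
  (contDiff_poleSq ω).contDiffAt.rpow_const_of_ne h.ne'

variable [FiniteDimensional ℝ E]

theorem laplacian_poleSq (ω ξ : E) : Δ (poleSq ω) ξ = 2 * finrank ℝ E * ‖ω‖ ^ 2 := by
  have h : fderiv ℝ (poleSq ω) =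
      fun y => ((2 * ‖ω‖ ^ 2) • innerSL ℝ : E →L[ℝ] E →L[ℝ] ℝ) y - innerSL ℝ ((2 : ℝ) • ω) := by
    ext y v
    rw [(hasFDerivAt_poleSq ω y).fderiv, map_sub, map_smul]
    rfl
  have h2 : ∀ i, ((2 * ‖ω‖ ^ 2) • innerSL ℝ : E →L[ℝ] E →L[ℝ] ℝ) (stdOrthonormalBasis ℝ E i)
      (stdOrthonormalBasis ℝ E i) = 2 * ‖ω‖ ^ 2 := fun i => by
    change (2 * ‖ω‖ ^ 2) * inner ℝ (stdOrthonormalBasis ℝ E i) (stdOrthonormalBasis ℝ E i) = _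
    simp
  rw [laplacian_eq_sum_fderiv_fderiv (stdOrthonormalBasis ℝ E), h, fderiv_sub_const,
    ContinuousLinearMap.fderiv]
  simp only [h2]
  simp
  ring

/-- The chain rule, with `|∇ poleSq ω|² = 4 |ω|² poleSq ω` and `Δ poleSq ω = 2 N |ω|²`. -/
theorem laplacian_comp_poleSq {φ φ' : ℝ → ℝ} {φ'' : ℝ} (ω ξ : E)
    (hφ : ∀ᶠ t in 𝓝 (poleSq ω ξ), HasDerivAt φ (φ' t) t)
    (hφ' : HasDerivAt φ' φ'' (poleSq ω ξ)) :
    Δ (fun y => φ (poleSq ω y)) ξ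
      = ‖ω‖ ^ 2 * (2 * finrank ℝ E * φ' (poleSq ω ξ) + 4 * poleSq ω ξ * φ'') := by
  rw [(contDiff_poleSq ω).contDiffAt.laplacian_comp (stdOrthonormalBasis ℝ E) hφ hφ',
    laplacian_poleSq, (hasFDerivAt_poleSq ω ξ).fderiv]
  have h := sum_inner_mul_apply (stdOrthonormalBasis ℝ E) ((2 * ‖ω‖ ^ 2) • ξ - (2 : ℝ) • ω)
    (innerSL ℝ ((2 * ‖ω‖ ^ 2) • ξ - (2 : ℝ) • ω))
  simp only [innerSL_apply_apply] at h
  simp only [innerSL_apply_apply, pow_two (inner ℝ _ _), h]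
  simp only [inner_sub_left, inner_sub_right, inner_smul_left, inner_smul_right,
    real_inner_self_eq_norm_sq, real_inner_comm ω ξ, poleSq]
  simp
  ring

theorem laplacian_poleSq_rpow (p : ℝ) {ω ξ : E} (h : 0 < poleSq ω ξ) :
    Δ (fun y => poleSq ω y ^ p) ξ
      = p * (4 * (p - 1) + 2 * finrank ℝ E) * ‖ω‖ ^ 2 * poleSq ω ξ ^ (p - 1) := by
  rw [laplacian_comp_poleSq (φ := fun t => t ^ p) (φ' := fun t => p * t ^ (p - 1))
    (φ'' := p * ((p - 1) * poleSq ω ξ ^ (p - 1 - 1))) ω ξ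
    ((lt_mem_nhds h).mono fun t ht => Real.hasDerivAt_rpow_const (Or.inl ht.ne'))
    ((Real.hasDerivAt_rpow_const (Or.inl h.ne')).const_mul p)]
  rw [Real.rpow_sub_one h.ne' (p - 1)]
  field_simp
  ring

theorem laplacian_log_poleSq {ω ξ : E} (h : 0 < poleSq ω ξ) :
    Δ (fun y => Real.log (poleSq ω y)) ξ
      = (2 * finrank ℝ E - 4) * ‖ω‖ ^ 2 * poleSq ω ξ ^ (-1 : ℝ) := by
  rw [laplacian_comp_poleSq (φ := Real.log) (φ' := fun t => t⁻¹)
    (φ'' := -(poleSq ω ξ ^ 2)⁻¹) ω ξ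
    ((lt_mem_nhds h).mono fun t ht => Real.hasDerivAt_log ht.ne') (hasDerivAt_inv h.ne')]
  rw [Real.rpow_neg_one]
  field_simp
  ring

theorem laplacian_laplacian_eq_zero_of_eventuallyEq {u h : E → ℝ} {ξ : E} {α : ℝ}
    (hu : Δ u =ᶠ[𝓝 ξ] α • h) (hh : ContDiffAt ℝ 2 h ξ) (h0 : Δ h ξ = 0) : Δ (Δ u) ξ = 0 := by
  rw [(laplacian_congr_nhds hu).self_of_nhds, laplacian_smul α hh, h0, smul_zero]

/-- The easy half of the Almansi decomposition: `(1 - ‖y‖²) h` is biharmonic when `h` is harmonic. -/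
theorem bilaplacian_add_one_sub_norm_sq_mul {u h : E → ℝ} {x : E} (hu : ContDiffAt ℝ 4 u x)
    (hh : ContDiffAt ℝ 4 h x) (hu0 : Δ (Δ u) x = 0) (hh0 : Δ h =ᶠ[𝓝 x] 0) :
    Δ (Δ (fun y => u y + (1 - ‖y‖ ^ 2) * h y : E → ℝ)) x = 0 := by
  have hev : Δ (fun y => u y + (1 - ‖y‖ ^ 2) * h y : E → ℝ) =ᶠ[𝓝 x]
      Δ u + ((-(2 * finrank ℝ E : ℝ)) • h + (-4 : ℝ) • fun y => fderiv ℝ h y y) := by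
    filter_upwards [hu.eventually (by simp), hh.eventually (by simp), hh0] with y hy hy' hy0
    have h1 : ContDiffAt ℝ 2 u y := hy.of_le (by norm_num)
    have h2 : ContDiffAt ℝ 2 h y := hy'.of_le (by norm_num)
    have h3 : ContDiffAt ℝ 2 (fun z => ‖z‖ ^ 2 * h z) y :=
      contDiff_norm_sq_real.contDiffAt.mul h2
    have h4 : ContDiffAt ℝ 2 (h - fun z => ‖z‖ ^ 2 * h z) y := h2.sub h3
    have e : (fun y => u y + (1 - ‖y‖ ^ 2) * h y) = u + (h - fun z => ‖z‖ ^ 2 * h z) := by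
      ext z; simp; ring
    rw [e, h1.laplacian_add h4, h2.laplacian_sub h3, h2.laplacian_norm_sq_mul, hy0]
    simp
    ring
  have hD : ContDiffAt ℝ 2 (fun y => fderiv ℝ h y y) x :=
    ((hh.fderiv_right (m := 3) (by norm_num)).of_le (by norm_num)).clm_apply contDiffAt_id
  have hh2 : ContDiffAt ℝ 2 h x := hh.of_le (by norm_num)
  have k1 : ContDiffAt ℝ 2 (Δ u) x := ContDiffAt.laplacian (hu.of_le (by norm_num))
  have k2 : ContDiffAt ℝ 2 ((-(2 * finrank ℝ E : ℝ)) • h) x :=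
    hh2.const_smul (-(2 * finrank ℝ E : ℝ))
  have k3 : ContDiffAt ℝ 2 ((-4 : ℝ) • fun y => fderiv ℝ h y y) x := hD.const_smul (-4 : ℝ)
  have k4 : ContDiffAt ℝ 2
    ((-(2 * finrank ℝ E : ℝ)) • h + (-4 : ℝ) • fun y => fderiv ℝ h y y) x := k2.add k3
  rw [(laplacian_congr_nhds hev).self_of_nhds, k1.laplacian_add k4, k2.laplacian_add k3,
    laplacian_smul _ hh2, laplacian_smul _ hD, (hh.of_le (by norm_num)).laplacian_fderiv_self,
    hu0, hh0.fderiv_eq, hh0.self_of_nhds]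
  simp

end ReflectedPole

/-! ### The two boundary value problems -/

section Solutions

variable {n : ℕ}

theorem IsBiharmonicSolution.congr {g g' f v v' : Euc n → ℝ} (h : IsBiharmonicSolution g f v)
    (hv : ∀ ξ ∈ closedBall (0 : Euc n) 1, v' ξ = v ξ)
    (hg : ∀ ξ ∈ sphere (0 : Euc n) 1, g' ξ = g ξ) : IsBiharmonicSolution g' f v' where
  contDiffOn_ball := h.contDiffOn_ball.congr fun ξ hξ => hv ξ (ball_subset_closedBall hξ)
  contDiffOn_closedBall := h.contDiffOn_closedBall.congr hv
  bilaplacian_eq ξ hξ := by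
    have he : v' =ᶠ[𝓝 ξ] v := by
      filter_upwards [closedBall_mem_nhds_of_mem hξ] with y hy using hv y hy
    rw [(laplacian_congr_nhds (laplacian_congr_nhds he)).self_of_nhds]
    exact h.bilaplacian_eq ξ hξ
  normalDeriv_eq ξ hξ := by
    rw [hg ξ hξ, ← h.normalDeriv_eq ξ hξ, normalDeriv, normalDeriv,
      fderivWithin_congr hv (hv ξ (sphere_subset_closedBall hξ))]
  boundary_eq ξ hξ := by
    rw [hv ξ (sphere_subset_closedBall hξ), h.boundary_eq ξ hξ]

theorem IsBiharmonicSolution.unique {g g' f v v' : Euc n → ℝ} (h : IsBiharmonicSolution g f v)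
    (h' : IsBiharmonicSolution g' f v') (hg : ∀ ξ ∈ sphere (0 : Euc n) 1, g ξ = g' ξ) :
    ∀ ξ ∈ closedBall (0 : Euc n) 1, v ξ = v' ξ := by
  intro ξ hξ
  have hat : ∀ x ∈ ball (0 : Euc n) 1, ContDiffAt ℝ 4 v x ∧ ContDiffAt ℝ 4 v' x := fun x hx =>
    ⟨h.contDiffOn_ball.contDiffAt (isOpen_ball.mem_nhds hx),
      h'.contDiffOn_ball.contDiffAt (isOpen_ball.mem_nhds hx)⟩
  have hz := biharmonic_eq_zero (w := v - v') (h.contDiffOn_ball.sub h'.contDiffOn_ball)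
    (h.contDiffOn_closedBall.sub h'.contDiffOn_closedBall)
    (fun x hx => by
      obtain ⟨h1, h2⟩ := hat x hx
      have k1 : ContDiffAt ℝ 2 v x := h1.of_le (by norm_num)
      have k2 : ContDiffAt ℝ 2 v' x := h2.of_le (by norm_num)
      have l1 : ContDiffAt ℝ 2 (Δ v) x := ContDiffAt.laplacian (h1.of_le (by norm_num))
      have l2 : ContDiffAt ℝ 2 (Δ v') x := ContDiffAt.laplacian (h2.of_le (by norm_num))
      rw [(laplacian_congr_nhds (k1.laplacian_sub_nhds k2)).self_of_nhds, l1.laplacian_sub l2,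
        h.bilaplacian_eq x hx, h'.bilaplacian_eq x hx, sub_zero])
    (fun x hx => by simp [h.boundary_eq x hx, h'.boundary_eq x hx])
    (fun x hx => by
      have hx' := sphere_subset_closedBall hx
      rw [fderivWithin_sub (uniqueDiffOn_unit_closedBall x hx')
        (h.contDiffOn_closedBall.differentiableOn (by norm_num) x hx')
        (h'.contDiffOn_closedBall.differentiableOn (by norm_num) x hx')]
      have e1 := h.normalDeriv_eq x hx
      have e2 := h'.normalDeriv_eq x hx
      rw [normalDeriv] at e1 e2
      simp [e1, e2, hg x hx]) ξ hξ
  simpa [sub_eq_zero] using hz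

/-- On the unit sphere `u + (1 - ‖ξ‖²) h` has the value `u` and the normal derivative
`Du(ξ) ξ - 2 h(ξ)`. -/
theorem isBiharmonicSolution_of_almansi {u h g f : Euc n → ℝ}
    (hu : ∀ ξ ∈ closedBall (0 : Euc n) 1, ContDiffAt ℝ 4 u ξ)
    (hh : ∀ ξ ∈ closedBall (0 : Euc n) 1, ContDiffAt ℝ 4 h ξ)
    (hu0 : ∀ ξ ∈ ball (0 : Euc n) 1, Δ (Δ u) ξ = 0)
    (hh0 : ∀ ξ ∈ ball (0 : Euc n) 1, Δ h ξ = 0)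
    (hf : ∀ ξ ∈ sphere (0 : Euc n) 1, u ξ = f ξ)
    (hg : ∀ ξ ∈ sphere (0 : Euc n) 1, fderiv ℝ u ξ ξ - 2 * h ξ = g ξ) :
    IsBiharmonicSolution g f fun ξ => u ξ + (1 - ‖ξ‖ ^ 2) * h ξ := by
  have hC : ∀ ξ ∈ closedBall (0 : Euc n) 1,
      ContDiffAt ℝ 4 (fun ξ => u ξ + (1 - ‖ξ‖ ^ 2) * h ξ) ξ := fun ξ hξ =>
    (hu ξ hξ).add ((contDiffAt_const.sub contDiff_norm_sq_real.contDiffAt).mul (hh ξ hξ))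
  refine ⟨fun ξ hξ => (hC ξ (ball_subset_closedBall hξ)).contDiffWithinAt,
    fun ξ hξ => ((hC ξ hξ).of_le (by norm_num)).contDiffWithinAt, fun ξ hξ => ?_,
    fun ξ hξ => ?_, fun ξ hξ => ?_⟩
  · refine bilaplacian_add_one_sub_norm_sq_mul (hu ξ (ball_subset_closedBall hξ))
      (hh ξ (ball_subset_closedBall hξ)) (hu0 ξ hξ) ?_
    filter_upwards [isOpen_ball.mem_nhds hξ] with y hy using hh0 y hy
  · have hξ' := sphere_subset_closedBall hξ
    have hn : ‖ξ‖ = 1 := by simpa using hξ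
    rw [normalDeriv, ((hC ξ hξ').differentiableAt (by norm_num)).fderivWithin
      (uniqueDiffOn_unit_closedBall ξ hξ'),
      ((((hu ξ hξ').differentiableAt (by norm_num)).hasFDerivAt).fun_add
        (((hasFDerivAt_norm_sq ξ).const_sub 1).fun_mul
          ((hh ξ hξ').differentiableAt (by norm_num)).hasFDerivAt)).fderiv, ← hg ξ hξ]
    simp [hn]
    ring
  · have hn : ‖ξ‖ = 1 := by simpa using hξ
    simp [hn, hf ξ hξ]

theorem F_sq (ξ ω : Euc n) : F ξ ω ^ 2 = poleSq ω ξ := by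
  unfold F poleSq
  split_ifs with h
  · simp [h]
  · have h0 : ‖ξ‖ ≠ 0 := norm_ne_zero_iff.2 h
    rw [norm_sub_sq_real, norm_smul, norm_smul, inner_smul_left, inner_smul_right,
      real_inner_comm]
    simp
    field_simp

theorem F_rpow (ξ ω : Euc n) (p : ℝ) : F ξ ω ^ p = poleSq ω ξ ^ (p / 2) := by
  have h : 0 ≤ F ξ ω := by
    unfold F
    split_ifs
    exacts [zero_le_one, norm_nonneg _]
  rw [← F_sq, ← Real.rpow_natCast_mul h]
  congr 1
  push_cast
  ring

/-- The rationalized form of `omegaZero`, free of the division by `‖z₀‖²`. -/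
theorem omegaZero_eq (z₀ : Euc n) (hz : ‖z₀‖ < 1) :
    omegaZero z₀ = (1 + √(1 - ‖z₀‖ ^ 2))⁻¹ • z₀ := by
  rcases eq_or_ne z₀ 0 with rfl | h
  · simp [omegaZero]
  · have h0 : ‖z₀‖ ≠ 0 := norm_ne_zero_iff.2 h
    have h1 : 0 ≤ 1 - ‖z₀‖ ^ 2 := by nlinarith [norm_nonneg z₀]
    have h2 := Real.sq_sqrt h1
    have h3 := Real.sqrt_nonneg (1 - ‖z₀‖ ^ 2)
    rw [omegaZero]
    congr 1
    field_simp
    linarith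

theorem norm_omegaZero_sq (z₀ : Euc n) (hz : ‖z₀‖ < 1) :
    1 + ‖omegaZero z₀‖ ^ 2 = 2 / (1 + √(1 - ‖z₀‖ ^ 2)) := by
  have h1 : 0 ≤ 1 - ‖z₀‖ ^ 2 := by nlinarith [norm_nonneg z₀]
  have h2 := Real.sq_sqrt h1
  have h3 := Real.sqrt_nonneg (1 - ‖z₀‖ ^ 2)
  rw [omegaZero_eq z₀ hz, norm_smul, norm_inv, Real.norm_of_nonneg (by positivity)]
  field_simp
  linarith

theorem norm_omegaZero_lt_one (z₀ : Euc n) (hz : ‖z₀‖ < 1) : ‖omegaZero z₀‖ < 1 := by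
  have h1 : 0 < 1 - ‖z₀‖ ^ 2 := by nlinarith [norm_nonneg z₀]
  have h3 := Real.sqrt_pos.2 h1
  have h4 : 2 / (1 + √(1 - ‖z₀‖ ^ 2)) < 2 := by
    rw [div_lt_iff₀ (by positivity)]; linarith
  rw [← norm_omegaZero_sq z₀ hz] at h4
  nlinarith [norm_nonneg (omegaZero z₀)]

/-- Since `z₀ = 2 ω₀ / (1 + |ω₀|²)`, the boundary data are functions of `|ξ - ω₀|²`, which is the
value of `poleSq ω₀` on the unit sphere. -/
theorem abs_one_sub_inner_eq (z₀ : Euc n) (hz : ‖z₀‖ < 1) {ξ : Euc n} (hξ : ‖ξ‖ = 1) :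
    |1 - inner ℝ z₀ ξ| = poleSq (omegaZero z₀) ξ / (1 + ‖omegaZero z₀‖ ^ 2) := by
  have h3 := Real.sqrt_nonneg (1 - ‖z₀‖ ^ 2)
  have h4 : 0 ≤ poleSq (omegaZero z₀) ξ / (1 + ‖omegaZero z₀‖ ^ 2) :=
    div_nonneg (poleSq_pos (norm_omegaZero_lt_one z₀ hz) hξ.le).le (by positivity)
  rw [← abs_of_nonneg h4]
  congr 1
  have h5 : inner ℝ (omegaZero z₀) ξ = (1 + √(1 - ‖z₀‖ ^ 2))⁻¹ * inner ℝ z₀ ξ := by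
    rw [omegaZero_eq z₀ hz, inner_smul_left]; simp
  have h6 : poleSq (omegaZero z₀) ξ = (1 + ‖omegaZero z₀‖ ^ 2) - 2 * inner ℝ (omegaZero z₀) ξ := by
    rw [poleSq, hξ]; ring
  rw [h6, norm_omegaZero_sq z₀ hz, h5]
  field_simp

theorem isBiharmonicSolution_log {z₀ : Euc 3} (hz : ‖z₀‖ < 1) :
    IsBiharmonicSolution (fun _ => 0) (fun ξ => -Real.log |1 - inner ℝ z₀ ξ|) fun ξ =>
      (-1 * Real.log (poleSq (omegaZero z₀) ξ) + Real.log (1 + ‖omegaZero z₀‖ ^ 2)) +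
        (1 - ‖ξ‖ ^ 2) *
          ((1 - ‖omegaZero z₀‖ ^ 2) / 2 * poleSq (omegaZero z₀) ξ ^ (-1 : ℝ) + -1 / 2) := by
  set ω := omegaZero z₀
  have hω : ‖ω‖ < 1 := norm_omegaZero_lt_one z₀ hz
  have hpos : ∀ ξ ∈ closedBall (0 : Euc 3) 1, 0 < poleSq ω ξ := fun ξ hξ =>
    poleSq_pos hω (by simpa using hξ)
  have hpow : ∀ m, ∀ ξ ∈ closedBall (0 : Euc 3) 1,
      ContDiffAt ℝ m (fun y => poleSq ω y ^ (-1 : ℝ)) ξ := fun m ξ hξ =>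
    contDiffAt_poleSq_rpow _ (hpos ξ hξ)
  have hlog : ∀ m, ∀ ξ ∈ closedBall (0 : Euc 3) 1,
      ContDiffAt ℝ m (fun y => Real.log (poleSq ω y)) ξ := fun m ξ hξ =>
    (contDiff_poleSq ω).contDiffAt.log (hpos ξ hξ).ne'
  have hΔpow : ∀ ξ ∈ closedBall (0 : Euc 3) 1, Δ (fun y => poleSq ω y ^ (-1 : ℝ)) ξ = 0 :=
    fun ξ hξ => by rw [laplacian_poleSq_rpow _ (hpos ξ hξ)]; norm_num
  refine isBiharmonicSolution_of_almansi
    (fun ξ hξ => (contDiffAt_const.mul (hlog 4 ξ hξ)).add contDiffAt_const)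
    (fun ξ hξ => (contDiffAt_const.mul (hpow 4 ξ hξ)).add contDiffAt_const)
    (fun ξ hξ => ?_) (fun ξ hξ => ?_) (fun ξ hξ => ?_) (fun ξ hξ => ?_)
  · have hξ' := ball_subset_closedBall hξ
    refine laplacian_laplacian_eq_zero_of_eventuallyEq (α := -4 * ‖ω‖ ^ 2) ?_ (hpow 2 ξ hξ')
      (hΔpow ξ hξ')
    filter_upwards [closedBall_mem_nhds_of_mem hξ] with y hy
    have k1 : ContDiffAt ℝ 2 ((-1 : ℝ) • fun y => Real.log (poleSq ω y)) y :=
      (hlog 2 y hy).const_smul (-1 : ℝ)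
    refine (k1.laplacian_add contDiffAt_const).trans ?_
    rw [laplacian_smul _ (hlog 2 y hy), laplacian_log_poleSq (hpos y hy)]
    simp only [finrank_euclideanSpace_fin, laplacian_const, Pi.zero_apply, Pi.smul_apply,
      smul_eq_mul]
    push_cast
    ring
  · have hξ' := ball_subset_closedBall hξ
    have k1 : ContDiffAt ℝ 2 (((1 - ‖ω‖ ^ 2) / 2) • fun y => poleSq ω y ^ (-1 : ℝ)) ξ :=
      (hpow 2 ξ hξ').const_smul ((1 - ‖ω‖ ^ 2) / 2)
    refine (k1.laplacian_add contDiffAt_const).trans ?_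
    rw [laplacian_smul _ (hpow 2 ξ hξ'), hΔpow ξ hξ']
    simp
  · have hn : ‖ξ‖ = 1 := by simpa using hξ
    rw [abs_one_sub_inner_eq z₀ hz hn, Real.log_div (hpos ξ (sphere_subset_closedBall hξ)).ne'
      (by positivity)]
    ring
  · have hn : ‖ξ‖ = 1 := by simpa using hξ
    have hp := hpos ξ (sphere_subset_closedBall hξ)
    rw [((((hasFDerivAt_poleSq ω ξ).log hp.ne').const_mul (-1)).add_const _).fderiv,
      Real.rpow_neg_one]
    simp [hn]
    field_simp
    rw [poleSq, hn]
    ring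

/-- Valid for every `n`; the boundary condition `η v = -(n - 3) / 2 * v` is written here with the
prescribed value of `v` on the sphere. -/
theorem isBiharmonicSolution_rpow {z₀ : Euc n} (hz : ‖z₀‖ < 1) :
    IsBiharmonicSolution
      (fun ξ => -(((n : ℝ) - 3) / 2) * |1 - inner ℝ z₀ ξ| ^ ((3 - (n : ℝ)) / 2))
      (fun ξ => |1 - inner ℝ z₀ ξ| ^ ((3 - (n : ℝ)) / 2)) fun ξ =>
        (1 + ‖omegaZero z₀‖ ^ 2) ^ (((n : ℝ) - 3) / 2)
            * poleSq (omegaZero z₀) ξ ^ ((3 - (n : ℝ)) / 2) +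
          (1 - ‖ξ‖ ^ 2) * ((1 + ‖omegaZero z₀‖ ^ 2) ^ (((n : ℝ) - 3) / 2)
            * (((n : ℝ) - 3) / 4 * (1 - ‖omegaZero z₀‖ ^ 2))
            * poleSq (omegaZero z₀) ξ ^ ((3 - (n : ℝ)) / 2 - 1)) := by
  set ω := omegaZero z₀
  have hω : ‖ω‖ < 1 := norm_omegaZero_lt_one z₀ hz
  set K := (1 + ‖ω‖ ^ 2) ^ (((n : ℝ) - 3) / 2) with hK
  set q := (3 - (n : ℝ)) / 2 with hq
  have hpos : ∀ ξ ∈ closedBall (0 : Euc n) 1, 0 < poleSq ω ξ := fun ξ hξ =>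
    poleSq_pos hω (by simpa using hξ)
  have hpow : ∀ (p : ℝ) (m), ∀ ξ ∈ closedBall (0 : Euc n) 1,
      ContDiffAt ℝ m (fun y => poleSq ω y ^ p) ξ := fun p m ξ hξ =>
    contDiffAt_poleSq_rpow _ (hpos ξ hξ)
  have hΔpow : ∀ ξ ∈ closedBall (0 : Euc n) 1, Δ (fun y => poleSq ω y ^ (q - 1)) ξ = 0 :=
    fun ξ hξ => by
      -- `q - 1 = -(n - 1) / 2` is the exponent of the Newtonian kernel in dimension `n + 1`.
      have h0 : 4 * (q - 1 - 1) + 2 * ((n + 1 : ℕ) : ℝ) = 0 := by rw [hq]; push_cast; ring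
      rw [laplacian_poleSq_rpow _ (hpos ξ hξ), finrank_euclideanSpace_fin, h0]
      ring
  have hbd : ∀ ξ ∈ sphere (0 : Euc n) 1, |1 - inner ℝ z₀ ξ| ^ q = K * poleSq ω ξ ^ q :=
    fun ξ hξ => by
      have hn : ‖ξ‖ = 1 := by simpa using hξ
      have e : ((n : ℝ) - 3) / 2 = -q := by rw [hq]; ring
      rw [abs_one_sub_inner_eq z₀ hz hn, Real.div_rpow (hpos ξ (sphere_subset_closedBall hξ)).le
        (by positivity), hK, e, Real.rpow_neg (by positivity)]
      ring
  refine isBiharmonicSolution_of_almansi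
    (fun ξ hξ => contDiffAt_const.mul (hpow _ 4 ξ hξ))
    (fun ξ hξ => contDiffAt_const.mul (hpow _ 4 ξ hξ))
    (fun ξ hξ => ?_) (fun ξ hξ => ?_) (fun ξ hξ => (hbd ξ hξ).symm) (fun ξ hξ => ?_)
  · have hξ' := ball_subset_closedBall hξ
    refine laplacian_laplacian_eq_zero_of_eventuallyEq
      (α := K * (q * (4 * (q - 1) + 2 * finrank ℝ (Euc n)) * ‖ω‖ ^ 2)) ?_ (hpow (q - 1) 2 ξ hξ')
      (hΔpow ξ hξ')
    filter_upwards [closedBall_mem_nhds_of_mem hξ] with y hy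
    refine (laplacian_smul K (hpow q 2 y hy)).trans ?_
    rw [laplacian_poleSq_rpow _ (hpos y hy)]
    simp only [Pi.smul_apply, smul_eq_mul]
    ring
  · have hξ' := ball_subset_closedBall hξ
    have h0 : Δ ((K * (((n : ℝ) - 3) / 4 * (1 - ‖ω‖ ^ 2))) •
        fun y => poleSq ω y ^ (q - 1)) ξ = 0 := by
      rw [laplacian_smul _ (hpow (q - 1) 2 ξ hξ'), hΔpow ξ hξ', smul_zero]
    exact h0
  · have hn : ‖ξ‖ = 1 := by simpa using hξ
    have hp := hpos ξ (sphere_subset_closedBall hξ)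
    have e : ((n : ℝ) - 3) = -2 * q := by rw [hq]; ring
    have hD : HasFDerivAt (fun y => K * poleSq ω y ^ q) (K • ((q * poleSq ω ξ ^ (q - 1)) •
        innerSL ℝ ((2 * ‖ω‖ ^ 2) • ξ - (2 : ℝ) • ω))) ξ :=
      ((hasFDerivAt_poleSq ω ξ).rpow_const (p := q) (Or.inl hp.ne')).const_mul K
    rw [hD.fderiv, hbd ξ hξ, Real.rpow_sub_one hp.ne', e]
    simp [hn]
    field_simp
    rw [poleSq, hn]
    ring

end Solutions

theorem theorem1p1 :
    (∀ n : ℕ, 1 ≤ n → ∀ z₀ ∈ ball (0 : Euc n) 1, omegaZero z₀ ∈ ball (0 : Euc n) 1) ∧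
    (∀ z₀ ∈ ball (0 : Euc 3) 1, ∀ v : Euc 3 → ℝ,
      IsBiharmonicSolution (fun _ => 0) (fun ξ => -Real.log |1 - inner ℝ z₀ ξ|) v ↔
        ∀ ξ ∈ closedBall (0 : Euc 3) 1,
          v ξ = -Real.log (F ξ (omegaZero z₀) ^ 2)
            + (1 - ‖ξ‖ ^ 2) / 2 * ((1 - ‖omegaZero z₀‖ ^ 2) / F ξ (omegaZero z₀) ^ 2 - 1)
            + Real.log (1 + ‖omegaZero z₀‖ ^ 2)) ∧
    (∀ n : ℕ, 3 < n → ∀ z₀ ∈ ball (0 : Euc n) 1, ∀ v : Euc n → ℝ,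
      IsBiharmonicSolution (fun ξ => -(((n : ℝ) - 3) / 2) * v ξ)
          (fun ξ => |1 - inner ℝ z₀ ξ| ^ ((3 - (n : ℝ)) / 2)) v ↔
        ∀ ξ ∈ closedBall (0 : Euc n) 1,
          v ξ = (1 + ‖omegaZero z₀‖ ^ 2) ^ (((n : ℝ) - 3) / 2)
              / F ξ (omegaZero z₀) ^ ((n : ℝ) - 3)
            * (1 + ((n : ℝ) - 3) * (1 - ‖omegaZero z₀‖ ^ 2) * (1 - ‖ξ‖ ^ 2)
                / (4 * F ξ (omegaZero z₀) ^ 2))) := by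
  refine ⟨fun n _ z₀ hz => ?_, fun z₀ hz v => ?_, fun n _ z₀ hz v => ?_⟩
  · exact mem_ball_zero_iff.2 (norm_omegaZero_lt_one z₀ (mem_ball_zero_iff.1 hz))
  · have hsol := isBiharmonicSolution_log (mem_ball_zero_iff.1 hz)
    refine Iff.trans ⟨fun h => h.unique hsol fun _ _ => rfl, fun h => hsol.congr h fun _ _ => rfl⟩
      (forall₂_congr fun ξ hξ => ?_)
    rw [F_sq, Real.rpow_neg_one]
    ring_nf
  · have hsol := isBiharmonicSolution_rpow (mem_ball_zero_iff.1 hz)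
    refine Iff.trans ⟨fun h => h.unique hsol fun ξ hξ => ?_, fun h => hsol.congr h fun ξ hξ => ?_⟩
      (forall₂_congr fun ξ hξ => ?_)
    · rw [h.boundary_eq ξ hξ]
    · rw [h ξ (sphere_subset_closedBall hξ), hsol.boundary_eq ξ hξ]
    · have hp : 0 < poleSq (omegaZero z₀) ξ :=
        poleSq_pos (norm_omegaZero_lt_one z₀ (mem_ball_zero_iff.1 hz)) (by simpa using hξ)
      have e : (3 - (n : ℝ)) / 2 = -(((n : ℝ) - 3) / 2) := by ring
      rw [F_sq, F_rpow, Real.rpow_sub_one hp.ne', e, Real.rpow_neg hp.le]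
      refine Eq.congr_right ?_
      have hP : 0 < poleSq (omegaZero z₀) ξ ^ (((n : ℝ) - 3) / 2) := Real.rpow_pos_of_pos hp _
      field_simp
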